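/- **Setting.** For $p\in\mathbb R^3$ put $p^0=\sqrt{1+|p|^2}$ and $p^\mu=(p^0,p)$, and use the Lorentz product $a^\mu b_\mu=-a^0b^0+\sum_{i=1}^3a^ib^i$. For $p,q\in\mathbb R^3$ and $\omega\in\mathbb S^2$ set $$s=-(p^\mu+q^\mu)(p_\mu+q_\mu),\quad g=\sqrt{(p^\mu-q^\mu)(p_\mu-q_\mu)},\quad v_{\mathrm M}=\frac{g\sqrt s}{p^0q^0},\quad \gamma=\frac{p^0+q^0}{\sqrt s},$$ $$p'=\frac{p+q}2+\frac g2\Big(\omega+(\gamma-1)(p+q)\frac{(p+q)\cdot\omega}{|p+q|^2}\Big),\qquad q'=\frac{p+q}2-\frac g2\Big(\omega+(\gamma-1)(p+q)\frac{(p+q)\cdot\omega}{|p+q|^2}\Big),$$ (the bracket being $\omega$ if $p+q=0$), and let $\theta\in[0,\pi]$ be given by $\cos\theta=(p^\mu-q^\mu)(p'_\mu-q'_\mu)/g^2$. Let the measurable scattering kernel satisfy $\sigma(g,\theta)\approx g\,\sigma_0(\theta)$, that is, $A^{-1}g\sigma_0(\theta)\le\sigma(g,\theta)\le A\,g\sigma_0(\theta)$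 for all $g\ge0$, $\theta\in[0,\pi]$, where $A>0$ and $\sigma_0$ is measurable with $0\le\sigma_0\le M$ on $[0,\pi]$, $M>0$. For non-negative measurable $f,h$ on $[0,1]\times\mathbb R^3$ the gain term is $$Q^+(f,h)(x_1,p)=\int_{\mathbb R^3}\int_{\mathbb S^2}v_{\mathrm M}\,\sigma(g,\theta)\,f(x_1,p')\,h(x_1,q')\,d\omega\,dq\in[0,\infty].$$ For $k>0$ let $\varphi(p)=e^{kp^0}$, let $\|f(\cdot,p)\|_{L^\infty_{x_1}}=\operatorname{ess\,sup}_{x_1\in[0,1]}|f(x_1,p)|$, and $$\|f\|=\int_{\mathbb R^3}(p^0)^{1/2}\varphi(p)\|f(\cdot,p)\|_{L^\infty_{x_1}}dp,\qquad \|f\|_{-1}=\sup_{a\in\mathbb R^3}\int_{\mathbb R^3}\frac{(p^0)^{1/2}\varphi(p)}{|p-a|}\|f(\cdot,p)\|_{L^\infty_{x_1}}dp .$$ **Statement (Lemma 3.2 and Corollary 3.3).** There is a constant $C>0$, depending only on $A$ and $M$, such that for all such $\sigma,\sigma_0$, all $k>0$, and all non-negative measurable $f,h$ on $[0,1]\times\mathbb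 R^3$, $$\int_{\mathbb R^3}\varphi(p)\,\|Q^+(f,h)(\cdot,p)\|_{L^\infty_{x_1}}\,dp\le \frac Ck\,\|f\|_{-1}\,\|h\|$$ and $$\int_{\mathbb R^3}\varphi(p)\,\|Q^+(f,h)(\cdot,p)\|_{L^\infty_{x_1}}\,dp\le \frac Ck\,\|h\|_{-1}\,\|f\| .$$ All quantities take values in $[0,\infty]$, with $0\cdot\infty=0$. -/

import Mathlib

open MeasureTheory
open scoped ENNReal

noncomputable section

namespace RelBoltzmann

/-- The momentum space `ℝ³` with its Euclidean structure. -/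
abbrev Mom : Type := EuclideanSpace ℝ (Fin 3)

/-- The unit sphere of `ℝ³`. -/
abbrev S2 : Type := Metric.sphere (0 : Mom) 1

/-- The surface measure `dω` on the unit sphere (of total mass `4π`). -/
def sphereMeasure : Measure S2 := (volume : Measure Mom).toSphere

/-- The particle energy `p⁰ = √(1 + |p|²)` (with `c = m = 1`). -/
def energy (p : Mom) : ℝ := Real.sqrt (1 + ‖p‖ ^ 2)

/-- The energy-momentum vector `(p⁰, p)`. -/
def fourMomentum (p : Mom) : ℝ × Mom := (energy p, p)

/-- The Lorentz inner product of two four-vectors, of signature `(-,+,+,+)`. -/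
def lorentzInner (a b : ℝ × Mom) : ℝ := -(a.1 * b.1) + inner ℝ a.2 b.2

/-- The square of the total energy in the center-of-momentum frame. -/
def sVar (p q : Mom) : ℝ :=
  -lorentzInner (fourMomentum p + fourMomentum q) (fourMomentum p + fourMomentum q)

/-- The relative momentum. -/
def gVar (p q : Mom) : ℝ :=
  Real.sqrt (lorentzInner (fourMomentum p - fourMomentum q) (fourMomentum p - fourMomentum q))

/-- The Møller velocity `g √s / (p⁰ q⁰)`. -/
def mollerVelocity (p q : Mom) : ℝ :=
  gVar p q * Real.sqrt (sVar p q) / (energy p * energy q)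

/-- The Lorentz factor `γ = (p⁰ + q⁰) / √s`. -/
def lorentzFactor (p q : Mom) : ℝ := (energy p + energy q) / Real.sqrt (sVar p q)

/-- `ω + (γ - 1) (p + q) ((p + q) · ω) / |p + q|²`. For `p + q = 0` one has `γ = 1` and this
is `ω`, in agreement with the convention for division by zero. -/
def boostedDirection (p q : Mom) (ω : S2) : Mom :=
  (ω : Mom) +
    ((lorentzFactor p q - 1) * (inner ℝ (p + q) (ω : Mom) / ‖p + q‖ ^ 2)) • (p + q)

/-- The post-collisional momentum `p'`. -/
def postP (p q : Mom) (ω : S2) : Mom :=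
  (1 / 2 : ℝ) • (p + q) + (gVar p q / 2) • boostedDirection p q ω

/-- The post-collisional momentum `q'`. -/
def postQ (p q : Mom) (ω : S2) : Mom :=
  (1 / 2 : ℝ) • (p + q) - (gVar p q / 2) • boostedDirection p q ω

/-- The scattering angle `θ ∈ [0, π]`, given by
`cos θ = (p^μ - q^μ)(p'_μ - q'_μ) / g²`. For `g = 0`, that is `p = q`, its value plays no role
in the collision operator. -/
def scatteringAngle (p q : Mom) (ω : S2) : ℝ :=
  Real.arccos (lorentzInner (fourMomentum p - fourMomentum q)
    (fourMomentum (postP p q ω) - fourMomentum (postQ p q ω)) / gVar p q ^ 2)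

/-- The relativistic hard-sphere assumption with angular cutoff: `σ(g, θ) ≈ g σ₀(θ)` with
comparison constant `A`, where `0 ≤ σ₀ ≤ M`. -/
structure IsHardSphereKernel (A M : ℝ) (σ : ℝ → ℝ → ℝ) (σ₀ : ℝ → ℝ) : Prop where
  measurable_kernel : Measurable (Function.uncurry σ)
  measurable_angular : Measurable σ₀
  angular_nonneg : ∀ θ ∈ Set.Icc 0 Real.pi, 0 ≤ σ₀ θ
  angular_le : ∀ θ ∈ Set.Icc 0 Real.pi, σ₀ θ ≤ M
  lower : ∀ g, 0 ≤ g → ∀ θ ∈ Set.Icc 0 Real.pi, g * σ₀ θ ≤ A * σ g θ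
  upper : ∀ g, 0 ≤ g → ∀ θ ∈ Set.Icc 0 Real.pi, σ g θ ≤ A * (g * σ₀ θ)

/-- The gain term `Q⁺(f, h)(x₁, p)` in the center-of-momentum representation, for non-negative
`f` and `h`; it takes values in `[0, ∞]`. -/
def gain (σ : ℝ → ℝ → ℝ) (f h : unitInterval → Mom → ℝ) (x : unitInterval) (p : Mom) : ℝ≥0∞ :=
  ∫⁻ q : Mom, ∫⁻ ω : S2,
    ENNReal.ofReal (mollerVelocity p q * σ (gVar p q) (scatteringAngle p q ω) *
      (f x (postP p q ω) * h x (postQ p q ω))) ∂sphereMeasure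

/-- The norm `‖f(·, p)‖_{L^∞_{x₁}}`, the essential supremum of `|f(x₁, p)|` over
`x₁ ∈ [0, 1]`. -/
def supNorm {ε : Type*} [ENorm ε] (f : unitInterval → Mom → ε) (p : Mom) : ℝ≥0∞ :=
  eLpNorm (fun x : unitInterval => f x p) ∞ volume

/-- The exponential weight `φ(p) = exp (k p⁰)`. -/
def expWeight (k : ℝ) (p : Mom) : ℝ := Real.exp (k * energy p)

/-- The norm `‖f‖ = ∫ ‖f(·, p)‖_{L^∞_{x₁}} (p⁰)^{1/2} φ(p) dp`. -/
def weightedNorm (k : ℝ) (f : unitInterval → Mom → ℝ) : ℝ≥0∞ :=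
  ∫⁻ p : Mom, ENNReal.ofReal (Real.sqrt (energy p) * expWeight k p) * supNorm f p

/-- The norm `‖f‖₋₁ = sup_a ∫ (p⁰)^{1/2} φ(p) |p - a|⁻¹ ‖f(·, p)‖_{L^∞_{x₁}} dp`. -/
def negNorm (k : ℝ) (f : unitInterval → Mom → ℝ) : ℝ≥0∞ :=
  ⨆ a : Mom, ∫⁻ p : Mom,
    ENNReal.ofReal (Real.sqrt (energy p) * expWeight k p / ‖p - a‖) * supNorm f p

end RelBoltzmann

end

open MeasureTheory
open scoped ENNReal

noncomputable section

namespace RelBoltzmann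

/-! Since `σ ≤ A M g`, the gain term at almost every `x₁` is at most `A M` times the same integral
with weight `v_M g` and with `f`, `h` replaced by `F = supNorm f`, `H = supNorm h`
(`supNorm_gain_le`). The pre-post collisional change of variables (`lintegral_collision`) then moves
the collision onto the weight: it remains to integrate `v_M g φ(p') F(p) H(q)`.

That change of variables is a symmetry in center-of-momentum coordinates: a pair is given by its
total momentum `P` and the momentum `u` of one particle in the rest frame, and a collision keeps `P`
and replaces `u` by `|u|ω`. The Jacobian times `v_M g` depends only on `P` and `|u|`, so `u` and
`|u|ω` may be exchanged.

The gain comes from the angular integral (`weight_mul_lintegral_le`). With `E = p⁰ + q⁰`, the energy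
of `p'` is `E/2 + |u| P·ω/(2u⁰)`, so `φ(p')` integrates over `ω` to at most a constant times
`exp(kE/2) e^β/β`, where `β = k|u||P|/(2u⁰) ≤ kE/2`. The exponentials are absorbed by `φ(p)φ(q)`,
and `v_M g/β` is at most `(16/k) √(p⁰q⁰)/|p+q|`. The kernel `1/|p+q|` is symmetric and is controlled
by the norm `‖·‖₋₁` of either factor, with `a = -q` or `a = -p`. -/

instance : IsFiniteMeasure sphereMeasure :=
  inferInstanceAs (IsFiniteMeasure (volume : Measure Mom).toSphere)

/-! ### Integration over the sphere and polar coordinates -/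

/-- Integration in polar coordinates. -/
lemma lintegral_polar {X : Mom → ℝ≥0∞} (hX : Measurable X) :
    ∫⁻ u, X u = ∫⁻ ω, ∫⁻ r : Set.Ioi (0 : ℝ), X (r.1 • (ω : Mom))
      ∂(Measure.volumeIoiPow 2) ∂sphereMeasure := by
  have hmp := Measure.measurePreserving_homeomorphUnitSphereProd (volume : Measure Mom)
  have hdim : Module.finrank ℝ Mom - 1 = 2 := by simp
  rw [hdim] at hmp
  have hm : Measurable fun z : S2 × Set.Ioi (0 : ℝ) => X (z.2.1 • (z.1 : Mom)) := by fun_prop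
  have h1 : ∫⁻ u, X u = ∫⁻ u : ({0}ᶜ : Set Mom), X u ∂(volume.comap Subtype.val) := by
    rw [lintegral_subtype_comap (measurableSet_singleton (0 : Mom)).compl,
      restrict_compl_singleton]
  rw [h1, ← lintegral_prod (fun z : S2 × Set.Ioi (0 : ℝ) => X (z.2.1 • (z.1 : Mom)))
    hm.aemeasurable]
  change _ = ∫⁻ z, _ ∂((volume : Measure Mom).toSphere.prod _)
  rw [← hmp.lintegral_comp hm]
  refine lintegral_congr fun u => ?_
  congr 1
  have hu : ‖(u : Mom)‖ ≠ 0 := norm_ne_zero_iff.2 u.2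
  simp [hu]

/-- A vector and an independent direction may be exchanged without changing the length. -/
lemma lintegral_swap_direction {X : Mom → Mom → ℝ≥0∞} (hX : Measurable (Function.uncurry X)) :
    ∫⁻ u, ∫⁻ ω : S2, X u (‖u‖ • (ω : Mom)) ∂sphereMeasure
      = ∫⁻ u, ∫⁻ ω : S2, X (‖u‖ • (ω : Mom)) u ∂sphereMeasure := by
  have hX' : ∀ {α : Type} [MeasurableSpace α] {a b : α → Mom}, Measurable a → Measurable b →
      Measurable fun z => X (a z) (b z) := fun ha hb => hX.comp (ha.prodMk hb)
  -- In polar coordinates both vectors have the same radius and independent directions, a form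
  -- symmetric under exchanging the two directions.
  have key : ∀ Y : Mom → Mom → ℝ≥0∞, Measurable (Function.uncurry Y) →
      ∫⁻ u, ∫⁻ ω : S2, Y u (‖u‖ • (ω : Mom)) ∂sphereMeasure
        = ∫⁻ r : Set.Ioi (0 : ℝ), ∫⁻ ω : S2, ∫⁻ ω' : S2, Y (r.1 • (ω : Mom)) (r.1 • (ω' : Mom))
          ∂sphereMeasure ∂sphereMeasure ∂(Measure.volumeIoiPow 2) := by
    intro Y hY
    have hY' : ∀ {α : Type} [MeasurableSpace α] {a b : α → Mom}, Measurable a → Measurable b →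
        Measurable fun z => Y (a z) (b z) := fun ha hb => hY.comp (ha.prodMk hb)
    have hm : Measurable fun u : Mom => ∫⁻ ω : S2, Y u (‖u‖ • (ω : Mom)) ∂sphereMeasure :=
      Measurable.lintegral_prod_right' (f := fun z : Mom × S2 => Y z.1 (‖z.1‖ • (z.2 : Mom)))
        (hY' (by fun_prop) (by fun_prop))
    rw [lintegral_polar hm, lintegral_lintegral_swap]
    · refine lintegral_congr fun r => lintegral_congr fun ω => lintegral_congr fun ω' => ?_
      have : ‖r.1 • (ω : Mom)‖ = r.1 := by
        rw [norm_smul, Real.norm_of_nonneg (le_of_lt r.2)]; simp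
      rw [this]
    · exact (hm.comp (g := fun u : Mom => _) (f := fun z : S2 × Set.Ioi (0 : ℝ) =>
        z.2.1 • (z.1 : Mom)) (by fun_prop)).aemeasurable
  rw [key X hX, key (fun u v => X v u) (hX.comp measurable_swap)]
  refine lintegral_congr fun r => lintegral_lintegral_swap ?_
  exact (hX' (α := S2 × S2) (by fun_prop) (by fun_prop)).aemeasurable

/-- Averaging over `0 < r < 1` with density `r²`, of mass `1/3`, turns a spherical integral into a
volume integral, where linear changes of variables are available. -/
lemma lintegral_sphere_le {Y : S2 → ℝ≥0∞} {G : Mom → ℝ≥0∞} (hG : Measurable G)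
    (h : ∀ (ω : S2) (r : ℝ), 0 < r → r < 1 → Y ω ≤ G (r • (ω : Mom))) :
    ∫⁻ ω, Y ω ∂sphereMeasure ≤ 3 * ∫⁻ u, G u := by
  set i1 : Set.Ioi (0 : ℝ) := ⟨1, by simp⟩
  have hν : Measure.volumeIoiPow 2 (Set.Iio i1) = 3⁻¹ := by
    rw [Measure.volumeIoiPow_apply_Iio]
    simp only [i1]
    norm_num
    rw [ENNReal.ofReal_div_of_pos (by norm_num)]
    simp
  have h1 : ∀ ω : S2, 3⁻¹ * Y ω ≤ ∫⁻ r : Set.Ioi (0 : ℝ), G (r.1 • (ω : Mom))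
      ∂(Measure.volumeIoiPow 2) := by
    intro ω
    calc 3⁻¹ * Y ω = ∫⁻ r in Set.Iio i1, Y ω ∂(Measure.volumeIoiPow 2) := by
          rw [setLIntegral_const, hν, mul_comm]
      _ ≤ ∫⁻ r in Set.Iio i1, G (r.1 • (ω : Mom)) ∂(Measure.volumeIoiPow 2) :=
          setLIntegral_mono' measurableSet_Iio fun r hr => h ω r.1 r.2 hr
      _ ≤ _ := setLIntegral_le_lintegral _ _
  rw [lintegral_polar hG]
  calc ∫⁻ ω, Y ω ∂sphereMeasure = 3 * ∫⁻ ω, 3⁻¹ * Y ω ∂sphereMeasure := by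
        rw [lintegral_const_mul' _ _ (by simp), ← mul_assoc,
          ENNReal.mul_inv_cancel (by simp) (by simp), one_mul]
    _ ≤ _ := by gcongr with ω; exact h1 ω

/-! ### Exponential integrals over the sphere -/

/-- The constant in the bound for exponential integrals over the sphere. -/
def sphereConst : ℝ := 3 * (Real.exp (1 / 2) * ∫ v : Mom, Real.exp (-(1 / 2) * ‖v‖ ^ 2))

lemma sphereConst_pos : 0 < sphereConst := by
  unfold sphereConst
  rw [GaussianFourier.integral_rexp_neg_mul_sq_norm (by norm_num)]
  positivity

/-- The linear map with factor `1` along the unit vector `e` and factor `b` on its complement. -/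
def anisotropic (b : ℝ) (e : Mom) : Mom →ₗ[ℝ] Mom :=
  b • LinearMap.transvection ((b⁻¹ - 1) • (innerₛₗ ℝ e)) e

lemma det_anisotropic {b : ℝ} (hb : 0 < b) {e : Mom} (he : ‖e‖ = 1) :
    (anisotropic b e).det = b ^ 2 := by
  rw [anisotropic, LinearMap.det_smul, LinearMap.transvection.det]
  simp [he]
  field_simp

lemma norm_anisotropic_sq {b : ℝ} (hb : 0 < b) {e : Mom} (he : ‖e‖ = 1) (x : Mom) :
    ‖anisotropic b e x‖ ^ 2 = b ^ 2 * (‖x‖ ^ 2 - inner ℝ e x ^ 2) + inner ℝ e x ^ 2 := by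
  have : anisotropic b e x = b • x + ((1 - b) * inner ℝ e x) • e := by
    simp only [anisotropic, LinearMap.smul_apply, LinearMap.transvection.apply, smul_add, smul_smul,
      innerₛₗ_apply_apply, smul_eq_mul]
    congr 2
    field_simp
  rw [this, norm_add_sq_real, norm_smul, norm_smul, he, inner_smul_left, inner_smul_right,
    real_inner_comm, mul_one, mul_pow, Real.norm_eq_abs, Real.norm_eq_abs, sq_abs, sq_abs]
  simp
  ring

/-- On the unit ball the integrand is dominated by `exp(β + 1/2)` times a Gaussian of width
`β^{-1/2}` in the two directions orthogonal to `e`. The determinant `β` of the anisotropic scaling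
supplies the factor `1/β`. -/
lemma lintegral_sphere_exp_le {β : ℝ} (hβ : 0 < β) {e : Mom} (he : ‖e‖ = 1) :
    ∫⁻ ω : S2, ENNReal.ofReal (Real.exp (β * inner ℝ e (ω : Mom))) ∂sphereMeasure
      ≤ ENNReal.ofReal (sphereConst * Real.exp β / β) := by
  set g : Mom → ℝ := fun v => Real.exp (-(1 / 2) * ‖v‖ ^ 2)
  have hgi : Integrable g := by
    -- A non-integrable function has integral `0` by convention, but the Gaussian integral is
    -- positive.
    by_contra hc
    have := integral_undef hc
    have h2 := GaussianFourier.integral_rexp_neg_mul_sq_norm (V := Mom) (b := 1 / 2) (by norm_num)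
    have h3 : 0 < (Real.pi / (1 / 2)) ^ ((Module.finrank ℝ Mom : ℝ) / 2) := by positivity
    rw [← h2] at h3
    exact h3.ne' this
  have hb : 0 < Real.sqrt β := Real.sqrt_pos.2 hβ
  have hL : (anisotropic (Real.sqrt β) e).det = β := by
    rw [det_anisotropic hb he, Real.sq_sqrt hβ.le]
  have hmap : ∫⁻ v, ENNReal.ofReal (g (anisotropic (Real.sqrt β) e v))
      = ENNReal.ofReal (β⁻¹ * ∫ v, g v) := by
    have hgm : Measurable fun v => ENNReal.ofReal (g v) := by fun_prop
    have hLm : Measurable (anisotropic (Real.sqrt β) e) :=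
      (LinearMap.continuous_of_finiteDimensional _).measurable
    rw [← lintegral_map hgm hLm, Measure.map_linearMap_addHaar_eq_smul_addHaar _ (by
      rw [hL]; exact hβ.ne'), hL, lintegral_smul_measure,
      ← ofReal_integral_eq_lintegral_ofReal hgi (Filter.Eventually.of_forall fun v =>
        (Real.exp_pos _).le), abs_of_pos (by positivity), smul_eq_mul,
      ← ENNReal.ofReal_mul (by positivity)]
  calc _ ≤ 3 * ∫⁻ v, ENNReal.ofReal (Real.exp (β + 1 / 2)) *
        ENNReal.ofReal (g (anisotropic (Real.sqrt β) e v)) := by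
        refine lintegral_sphere_le ?_ fun ω r hr hr1 => ?_
        · have hLm : Measurable (anisotropic (Real.sqrt β) e) :=
            (LinearMap.continuous_of_finiteDimensional _).measurable
          fun_prop
        · rw [← ENNReal.ofReal_mul (Real.exp_pos _).le, ← Real.exp_add]
          refine ENNReal.ofReal_le_ofReal (Real.exp_le_exp.2 ?_)
          have hω : ‖(ω : Mom)‖ = 1 := by simp
          rw [norm_anisotropic_sq hb he, Real.sq_sqrt hβ.le, norm_smul, hω, inner_smul_right,
            mul_one, Real.norm_eq_abs, sq_abs]
          have ht := abs_real_inner_le_norm e (ω : Mom)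
          rw [he, hω, mul_one, abs_le] at ht
          set t : ℝ := inner ℝ e (ω : Mom)
          have ht2 : t ^ 2 ≤ 1 := by nlinarith
          have hr2 : r ^ 2 ≤ 1 := by nlinarith
          have h1 : r ^ 2 * t ^ 2 ≤ 1 := by nlinarith [sq_nonneg r, sq_nonneg t]
          -- From `1 - t² = (1 - t)(1 + t)` and `t ≤ 1`: the transverse part of the Gaussian
          -- exponent is paid for by `β(1 - t)`, the axial part by `1/2`.
          have h2 : r ^ 2 * (1 - t ^ 2) ≤ 2 * (1 - t) := by nlinarith [sq_nonneg (1 - t)]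
          nlinarith [mul_le_mul_of_nonneg_left h2 hβ.le]
    _ = _ := by
        rw [lintegral_const_mul' _ _ (by simp), hmap, ← ENNReal.ofReal_mul (Real.exp_pos _).le]
        rw [show (3 : ℝ≥0∞) = ENNReal.ofReal 3 by simp, ← ENNReal.ofReal_mul (by norm_num)]
        congr 1
        rw [Real.exp_add, sphereConst]
        simp only [g]
        ring

/-! ### Energies and the invariants `s` and `g` -/

lemma energy_sq (p : Mom) : energy p ^ 2 = 1 + ‖p‖ ^ 2 := Real.sq_sqrt (by positivity)

lemma energy_pos (p : Mom) : 0 < energy p := Real.sqrt_pos.2 (by positivity)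

lemma norm_le_energy (p : Mom) : ‖p‖ ≤ energy p := Real.le_sqrt_of_sq_le (by linarith)

lemma sVar_eq (p q : Mom) : sVar p q = (energy p + energy q) ^ 2 - ‖p + q‖ ^ 2 := by
  simp only [sVar, lorentzInner, fourMomentum, Prod.fst_add, Prod.snd_add,
    real_inner_self_eq_norm_sq]
  ring

lemma gVar_eq (p q : Mom) : gVar p q = Real.sqrt (‖p - q‖ ^ 2 - (energy p - energy q) ^ 2) := by
  simp only [gVar, lorentzInner, fourMomentum, Prod.fst_sub, Prod.snd_sub,
    real_inner_self_eq_norm_sq]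
  congr 1
  ring

lemma one_add_inner_le (p q : Mom) : 1 + |inner ℝ p q| ≤ energy p * energy q := by
  refine (add_le_add_right (abs_real_inner_le_norm p q) 1).trans ?_
  refine abs_le_of_sq_le_sq' ?_ (mul_pos (energy_pos p) (energy_pos q)).le |>.2
  rw [mul_pow, energy_sq, energy_sq]
  nlinarith [sq_nonneg (‖p‖ - ‖q‖)]

lemma sVar_eq' (p q : Mom) : sVar p q = 2 + 2 * (energy p * energy q) - 2 * inner ℝ p q := by
  rw [sVar_eq, norm_add_sq_real, add_sq, energy_sq, energy_sq]
  ring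

lemma four_le_sVar (p q : Mom) : 4 ≤ sVar p q := by
  have := one_add_inner_le p q
  rw [sVar_eq']
  linarith [le_abs_self (inner ℝ p q)]

lemma sVar_le (p q : Mom) : sVar p q ≤ 4 * (energy p * energy q) := by
  have := one_add_inner_le p q
  rw [sVar_eq']
  linarith [neg_abs_le (inner ℝ p q)]

/-! ### Center-of-momentum coordinates -/

/-- The total energy of two particles with total momentum `P`, whose momenta in the
center-of-momentum frame are `u` and `-u`. -/
def cmEnergy (P u : Mom) : ℝ := Real.sqrt ((2 * energy u) ^ 2 + ‖P‖ ^ 2)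

/-- The coefficient of the boost from the center-of-momentum frame. -/
def cmCoeff (P u : Mom) : ℝ := 1 / (2 * energy u * (2 * energy u + cmEnergy P u))

/-- The momentum of a particle of momentum `u` in the center-of-momentum frame of a pair
with total momentum `P`. -/
def cmMap (P u : Mom) : Mom := (1 / 2 : ℝ) • P + u + (cmCoeff P u * inner ℝ P u) • P

lemma cmEnergy_sq (P u : Mom) : cmEnergy P u ^ 2 = (2 * energy u) ^ 2 + ‖P‖ ^ 2 :=
  Real.sq_sqrt (by positivity)

lemma cmEnergy_pos (P u : Mom) : 0 < cmEnergy P u := by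
  have := energy_pos u
  exact Real.sqrt_pos.2 (by positivity)

lemma energy_congr {u v : Mom} (h : ‖u‖ = ‖v‖) : energy u = energy v := by simp [energy, h]

lemma cmEnergy_congr (P : Mom) {u v : Mom} (h : ‖u‖ = ‖v‖) : cmEnergy P u = cmEnergy P v := by
  simp [cmEnergy, energy_congr h]

lemma cmCoeff_congr (P : Mom) {u v : Mom} (h : ‖u‖ = ‖v‖) : cmCoeff P u = cmCoeff P v := by
  simp [cmCoeff, energy_congr h, cmEnergy_congr P h]

lemma cmMap_neg (P u : Mom) : cmMap P (-u) = P - cmMap P u := by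
  simp only [cmMap, cmCoeff_congr P (norm_neg u), inner_neg_right]
  module

/-- This is the time component of the Lorentz boost with velocity `P/E` and factor `E/(2u⁰)`. It is
checked by squaring, using `|P|² = E² - (2u⁰)²`; the right side is non-negative by Cauchy-Schwarz.
-/
lemma energy_cmMap (P u : Mom) :
    energy (cmMap P u) = cmEnergy P u / 2 + inner ℝ P u / (2 * energy u) := by
  have hR := energy_pos u
  have hE := cmEnergy_pos P u
  have hE2 := cmEnergy_sq P u
  have hR2 := energy_sq u
  have hPE : ‖P‖ ≤ cmEnergy P u := Real.le_sqrt_of_sq_le (by nlinarith)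
  have hin := abs_real_inner_le_norm P u
  have huR := norm_le_energy u
  have hc : cmCoeff P u * (2 * energy u * (2 * energy u + cmEnergy P u)) = 1 := by
    rw [cmCoeff]; field_simp
  rw [energy, Real.sqrt_eq_iff_eq_sq (by positivity)]
  · have hn : ‖cmMap P u‖ ^ 2 = ‖P‖ ^ 2 / 4 + ‖u‖ ^ 2 + (cmCoeff P u * inner ℝ P u) ^ 2 * ‖P‖ ^ 2
        + inner ℝ P u + cmCoeff P u * inner ℝ P u * ‖P‖ ^ 2
        + 2 * cmCoeff P u * inner ℝ P u ^ 2 := by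
      rw [← real_inner_self_eq_norm_sq]
      simp only [cmMap, inner_add_left, inner_add_right, inner_smul_left, inner_smul_right,
        real_inner_self_eq_norm_sq, real_inner_comm P u]
      simp
      ring
    rw [hn]
    generalize (inner ℝ P u : ℝ) = a at *
    generalize cmEnergy P u = E at *
    generalize energy u = R at *
    have hcP : cmCoeff P u * ‖P‖ ^ 2 = E / (2 * R) - 1 := by
      have : ‖P‖ ^ 2 = (E - 2 * R) * (E + 2 * R) := by linarith
      rw [this]
      field_simp
      linear_combination (E - 2 * R) * hc
    have h3 : cmCoeff P u * (1 + E / (2 * R)) = 1 / (2 * R) ^ 2 := by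
      field_simp
      linear_combination hc
    have : (cmCoeff P u * a) ^ 2 * ‖P‖ ^ 2 = cmCoeff P u * a ^ 2 * (E / (2 * R) - 1) := by
      rw [← hcP]; ring
    have h4 : cmCoeff P u * a * ‖P‖ ^ 2 = a * (E / (2 * R) - 1) := by rw [← hcP]; ring
    rw [this, h4]
    have h5 : ‖u‖ ^ 2 = R ^ 2 - 1 := by linarith
    have h6 : ‖P‖ ^ 2 = E ^ 2 - (2 * R) ^ 2 := by linarith
    rw [h5, h6]
    linear_combination a ^ 2 * h3
  · have h1 : |(inner ℝ P u : ℝ)| ≤ cmEnergy P u * energy u :=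
      hin.trans (mul_le_mul hPE huR (norm_nonneg _) hE.le)
    have h2 := (abs_le.1 h1).1
    have : cmEnergy P u / 2 + inner ℝ P u / (2 * energy u)
        = (cmEnergy P u * energy u + inner ℝ P u) / (2 * energy u) := by field_simp
    rw [this]
    exact div_nonneg (by linarith) (by positivity)

lemma energy_cmMap_neg (P u : Mom) :
    energy (cmMap P (-u)) = cmEnergy P u / 2 - inner ℝ P u / (2 * energy u) := by
  rw [energy_cmMap, cmEnergy_congr P (norm_neg u), energy_congr (norm_neg u), inner_neg_right]
  ring

lemma cmMap_add_neg (P u : Mom) : cmMap P u + cmMap P (-u) = P := by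
  rw [cmMap_neg]; abel

lemma energy_cmMap_add (P u : Mom) :
    energy (cmMap P u) + energy (cmMap P (-u)) = cmEnergy P u := by
  rw [energy_cmMap, energy_cmMap_neg]; ring

lemma sVar_cmMap (P u : Mom) : sVar (cmMap P u) (cmMap P (-u)) = (2 * energy u) ^ 2 := by
  rw [sVar_eq, energy_cmMap_add, cmMap_add_neg, cmEnergy_sq]; ring

lemma gVar_sq (p q : Mom) : gVar p q ^ 2 = sVar p q - 4 := by
  have h : ‖p - q‖ ^ 2 - (energy p - energy q) ^ 2 = sVar p q - 4 := by
    rw [sVar_eq', norm_sub_sq_real, sub_sq, energy_sq, energy_sq]; ring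
  rw [gVar_eq, h, Real.sq_sqrt (by linarith [four_le_sVar p q])]

lemma gVar_nonneg (p q : Mom) : 0 ≤ gVar p q := Real.sqrt_nonneg _

lemma gVar_cmMap (P u : Mom) : gVar (cmMap P u) (cmMap P (-u)) = 2 * ‖u‖ := by
  refine (pow_left_inj₀ (gVar_nonneg _ _) (by positivity) two_ne_zero).1 ?_
  rw [gVar_sq, sVar_cmMap, mul_pow, energy_sq]; ring

lemma cmCoeff_eq {P : Mom} (hP : P ≠ 0) (u : Mom) :
    cmCoeff P u = (cmEnergy P u / (2 * energy u) - 1) / ‖P‖ ^ 2 := by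
  have hR := energy_pos u
  have hE := cmEnergy_pos P u
  have hP' : ‖P‖ ≠ 0 := norm_ne_zero_iff.2 hP
  have : ‖P‖ ^ 2 = (cmEnergy P u - 2 * energy u) * (cmEnergy P u + 2 * energy u) := by
    linarith [cmEnergy_sq P u]
  rw [cmCoeff]
  field_simp
  linear_combination this

lemma boost_cmMap (P u : Mom) (ω : S2) :
    ‖u‖ • boostedDirection (cmMap P u) (cmMap P (-u)) ω
      = ‖u‖ • (ω : Mom) + (cmCoeff P u * inner ℝ P (‖u‖ • (ω : Mom))) • P := by
  rw [boostedDirection, lorentzFactor, energy_cmMap_add, sVar_cmMap, cmMap_add_neg,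
    Real.sqrt_sq (by linarith [energy_pos u])]
  rcases eq_or_ne P 0 with rfl | hP
  · simp
  · rw [cmCoeff_eq hP, inner_smul_right]
    module

lemma norm_smul_sphere (u : Mom) (ω : S2) : ‖‖u‖ • (ω : Mom)‖ = ‖u‖ := by
  simp [norm_smul]

lemma postP_cmMap (P u : Mom) (ω : S2) :
    postP (cmMap P u) (cmMap P (-u)) ω = cmMap P (‖u‖ • (ω : Mom)) := by
  rw [postP, gVar_cmMap, mul_div_cancel_left₀ _ two_ne_zero, boost_cmMap, cmMap_add_neg, cmMap,
    cmCoeff_congr P (norm_smul_sphere u ω), add_assoc]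

lemma postQ_cmMap (P u : Mom) (ω : S2) :
    postQ (cmMap P u) (cmMap P (-u)) ω = cmMap P (-(‖u‖ • (ω : Mom))) := by
  rw [cmMap_neg P (_ • _), postQ, gVar_cmMap, mul_div_cancel_left₀ _ two_ne_zero, boost_cmMap, cmMap_add_neg,
    cmMap, cmCoeff_congr P (norm_smul_sphere u ω)]
  module

lemma inner_cmMap_sub (P u : Mom) :
    inner ℝ P (cmMap P u - (1 / 2 : ℝ) • P) = cmEnergy P u / (2 * energy u) * inner ℝ P u := by
  have hR := energy_pos u
  have hE := cmEnergy_pos P u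
  have hE2 := cmEnergy_sq P u
  have : ‖P‖ ^ 2 = (cmEnergy P u - 2 * energy u) * (cmEnergy P u + 2 * energy u) := by linarith
  have h1 : cmMap P u - (1 / 2 : ℝ) • P = u + (cmCoeff P u * inner ℝ P u) • P := by
    rw [cmMap]; abel
  rw [h1, inner_add_right, inner_smul_right, real_inner_self_eq_norm_sq, this, cmCoeff]
  field_simp
  ring

/-- The image recovers `|u|` through `g = 2|u|`, then `P·u` through `inner_cmMap_sub`, and these fix
the boost correction to `u`. -/
lemma cmMap_injective (P : Mom) : Function.Injective (cmMap P) := by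
  intro u v h
  have h' : cmMap P (-u) = cmMap P (-v) := by rw [cmMap_neg, cmMap_neg, h]
  have hg := gVar_cmMap P u
  rw [h, h', gVar_cmMap] at hg
  have hn : ‖u‖ = ‖v‖ := by linarith
  have hi := inner_cmMap_sub P u
  rw [h, inner_cmMap_sub, cmEnergy_congr P hn, energy_congr hn] at hi
  have hne : cmEnergy P v / (2 * energy v) ≠ 0 :=
    (div_pos (cmEnergy_pos P v) (by linarith [energy_pos v])).ne'
  have hin := mul_left_cancel₀ hne hi
  simp only [cmMap, cmCoeff_congr P hn, hin] at h
  simpa using h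

lemma cmMap_surjective (P : Mom) : Function.Surjective (cmMap P) := by
  intro p
  obtain ⟨q, hq⟩ : ∃ q, q = P - p := ⟨_, rfl⟩
  have hPq : p + q = P := by rw [hq]; abel
  obtain ⟨E, hE⟩ : ∃ E, E = energy p + energy q := ⟨_, rfl⟩
  obtain ⟨R, hR⟩ : ∃ R, R = Real.sqrt (sVar p q) := ⟨_, rfl⟩
  have hs := four_le_sVar p q
  have hR2 : R ^ 2 = E ^ 2 - ‖P‖ ^ 2 := by
    rw [hR, Real.sq_sqrt (by linarith), sVar_eq, hPq, hE]
  have hRpos : 0 < R := hR ▸ Real.sqrt_pos.2 (by linarith)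
  have hEpos : 0 < E := by linarith [energy_pos p, energy_pos q]
  obtain ⟨w, hw⟩ : ∃ w, w = p - (1 / 2 : ℝ) • P := ⟨_, rfl⟩
  have hw' : w = (1 / 2 : ℝ) • (p - q) := by rw [hw, ← hPq]; module
  obtain ⟨b, hb⟩ : ∃ b : ℝ, b = inner ℝ P w := ⟨_, rfl⟩
  have hbE : b = E * (energy p - energy q) / 2 := by
    rw [hb, hw', ← hPq, inner_smul_right, inner_sub_right, inner_add_left, inner_add_left,
      real_inner_self_eq_norm_sq, real_inner_self_eq_norm_sq, real_inner_comm p q, hE]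
    linear_combination (energy_sq q - energy_sq p) / 2
  have hw2 : ‖w‖ ^ 2 = (R ^ 2 - 4) / 4 + (b / E) ^ 2 := by
    have h1 : ‖w‖ ^ 2 = ‖p - q‖ ^ 2 / 4 := by
      rw [hw', norm_smul, mul_pow]; norm_num; ring
    have h2 := gVar_sq p q
    have h3 : ‖p - q‖ ^ 2 = sVar p q - 4 + (energy p - energy q) ^ 2 := by
      rw [sVar_eq', norm_sub_sq_real, sub_sq, energy_sq, energy_sq]; ring
    have h4 : b / E = (energy p - energy q) / 2 := by rw [hbE]; field_simp
    have h5 : R ^ 2 = sVar p q := by rw [hR, Real.sq_sqrt (by linarith)]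
    rw [h1, h3, h4, h5]; ring
  have hP2 : ‖P‖ ^ 2 = (E - R) * (E + R) := by linarith
  -- The inverse boost, with `E` and `R = √s` the total energies in the original and rest frames.
  obtain ⟨u, hu⟩ : ∃ u, u = w - (b / (E * (R + E))) • P := ⟨_, rfl⟩
  have hu2 : ‖u‖ ^ 2 = (R ^ 2 - 4) / 4 := by
    rw [hu, norm_sub_sq_real, norm_smul, inner_smul_right, real_inner_comm, ← hb, mul_pow, hP2, hw2,
      Real.norm_eq_abs, sq_abs]
    field_simp
    ring
  have hen : 2 * energy u = R := by
    refine (pow_left_inj₀ (by linarith [energy_pos u]) hRpos.le two_ne_zero).1 ?_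
    rw [mul_pow, energy_sq, hu2]; ring
  have hcE : cmEnergy P u = E := by
    refine (pow_left_inj₀ (cmEnergy_pos P u).le hEpos.le two_ne_zero).1 ?_
    rw [cmEnergy_sq, hen, hR2]; ring
  refine ⟨u, ?_⟩
  have hPu : (inner ℝ P u : ℝ) = R / E * b := by
    rw [hu, inner_sub_right, inner_smul_right, real_inner_self_eq_norm_sq, ← hb, hP2]
    field_simp
    ring
  have hp : p = (1 / 2 : ℝ) • P + w := by rw [hw]; abel
  have hc : cmCoeff P u * inner ℝ P u = b / (E * (R + E)) := by
    rw [cmCoeff, hPu, hen, hcE]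
    field_simp
  rw [cmMap, hc, hu, hp]
  abel

/-! ### The Jacobian of the center-of-momentum coordinates -/

/-- The coefficient of the boost as a function of `t = |u|²`. -/
def boostCoeff (a t : ℝ) : ℝ :=
  1 / (2 * Real.sqrt (1 + t) * (2 * Real.sqrt (1 + t) + Real.sqrt ((2 * Real.sqrt (1 + t)) ^ 2 + a)))

lemma hasDerivAt_boostCoeff {a t : ℝ} (ha : 0 ≤ a) (ht : 0 ≤ t) :
    HasDerivAt (boostCoeff a) (-2 / ((2 * Real.sqrt (1 + t)) ^ 3 *
      Real.sqrt ((2 * Real.sqrt (1 + t)) ^ 2 + a))) t := by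
  have h1 : 0 < 1 + t := by linarith
  have h2 : 0 < (2 * Real.sqrt (1 + t)) ^ 2 + a := by positivity
  have hR : HasDerivAt (fun t => 2 * Real.sqrt (1 + t)) (2 * (1 / (2 * Real.sqrt (1 + t)))) t :=
    (((hasDerivAt_id t).const_add 1).sqrt h1.ne').const_mul 2
  have hE := ((hR.pow 2).add_const a).sqrt h2.ne'
  have hRpos : 0 < Real.sqrt (1 + t) := Real.sqrt_pos.2 h1
  have hEpos := Real.sqrt_pos.2 h2
  have h := (hR.mul (hR.add hE)).inv (by simp only [Pi.mul_apply, Pi.add_apply]; positivity)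
  have h3 : boostCoeff a = (fun t => (2 * Real.sqrt (1 + t) * (2 * Real.sqrt (1 + t) +
    Real.sqrt ((2 * Real.sqrt (1 + t)) ^ 2 + a)))⁻¹) := by
    ext; simp [boostCoeff]
  rw [h3]
  refine h.congr_deriv ?_
  simp only [Pi.mul_apply, Pi.add_apply, Pi.pow_apply]
  field_simp
  ring

/-- The derivative of `cmMap P` at `u`. -/
def cmDeriv (P u : Mom) : Mom →L[ℝ] Mom :=
  ContinuousLinearMap.id ℝ Mom + (cmCoeff P u • innerSL ℝ P +
    (inner ℝ P u : ℝ) • ((-2 / ((2 * energy u) ^ 3 * cmEnergy P u)) • (2 • innerSL ℝ u))).smulRight P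

lemma hasFDerivAt_cmMap (P u : Mom) : HasFDerivAt (cmMap P) (cmDeriv P u) u := by
  have h1 : HasFDerivAt (cmCoeff P)
      ((-2 / ((2 * energy u) ^ 3 * cmEnergy P u)) • (2 • innerSL ℝ u)) u :=
    HasDerivAt.comp_hasFDerivAt (h₂ := boostCoeff (‖P‖ ^ 2)) (f := fun v : Mom => ‖v‖ ^ 2) u
      (hasDerivAt_boostCoeff (by positivity) (by positivity))
      (hasStrictFDerivAt_norm_sq u).hasFDerivAt
  have h2 : HasFDerivAt (fun v : Mom => (inner ℝ P v : ℝ)) (innerSL ℝ P) u :=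
    (innerSL ℝ P).hasFDerivAt
  exact ((hasFDerivAt_id u).const_add ((1 / 2 : ℝ) • P)).add ((h1.mul h2).smul_const P)

/-- The derivative is a rank-one perturbation of the identity, so its determinant is `1` plus the
functional evaluated at `P`. -/
lemma det_cmDeriv (P u : Mom) : (cmDeriv P u).det
    = 4 * (energy (cmMap P u) * energy (cmMap P (-u))) / (2 * energy u * cmEnergy P u) := by
  have h : ((cmDeriv P u : Mom →L[ℝ] Mom) : Mom →ₗ[ℝ] Mom) = LinearMap.transvection
      ((cmCoeff P u • innerSL ℝ P + (inner ℝ P u : ℝ) •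
        ((-2 / ((2 * energy u) ^ 3 * cmEnergy P u)) • (2 • innerSL ℝ u)) : Mom →L[ℝ] ℝ) :
        Mom →ₗ[ℝ] ℝ) P := by
    ext v
    simp [cmDeriv, LinearMap.transvection.apply]
  rw [ContinuousLinearMap.det, h, LinearMap.transvection.det, energy_cmMap, energy_cmMap_neg]
  have hR := energy_pos u
  have hE := cmEnergy_pos P u
  have : ‖P‖ ^ 2 = (cmEnergy P u - 2 * energy u) * (cmEnergy P u + 2 * energy u) := by
    linarith [cmEnergy_sq P u]
  simp only [ContinuousLinearMap.coe_coe, add_apply, smul_apply, innerSL_apply_apply, real_inner_self_eq_norm_sq, smul_eq_mul,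
    this, cmCoeff, nsmul_eq_mul, real_inner_comm P u]
  field_simp
  push_cast
  ring

@[fun_prop]
lemma continuous_energy : Continuous energy := by unfold energy; fun_prop

@[fun_prop]
lemma continuous_cmEnergy : Continuous fun z : Mom × Mom => cmEnergy z.1 z.2 := by
  unfold cmEnergy; fun_prop

lemma measurable_cmMap : Measurable fun z : Mom × Mom => cmMap z.1 z.2 := by
  have := continuous_cmEnergy.measurable
  unfold cmMap cmCoeff
  fun_prop

/-- The change of variables to center-of-momentum coordinates. -/
lemma lintegral_cm {G : Mom → Mom → ℝ≥0∞} (hG : Measurable (Function.uncurry G)) :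
    ∫⁻ p, ∫⁻ q, G p q = ∫⁻ P, ∫⁻ u, ENNReal.ofReal
      (4 * (energy (cmMap P u) * energy (cmMap P (-u))) / (2 * energy u * cmEnergy P u)) *
        G (cmMap P u) (cmMap P (-u)) := by
  have h1 : ∀ p, ∫⁻ q, G p q = ∫⁻ P, G p (P - p) := fun p =>
    (lintegral_sub_right_eq_self (fun q => G p q) p).symm
  simp_rw [h1]
  rw [lintegral_lintegral_swap (f := fun p P => G p (P - p))
    (hG.comp (measurable_fst.prodMk (measurable_snd.sub measurable_fst))).aemeasurable]
  refine lintegral_congr fun P => ?_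
  have h2 := lintegral_image_eq_lintegral_abs_det_fderiv_mul volume (MeasurableSet.univ (α := Mom))
    (fun u _ => (hasFDerivAt_cmMap P u).hasFDerivWithinAt) (cmMap_injective P).injOn
    (fun p => G p (P - p))
  rw [Set.image_univ, (cmMap_surjective P).range_eq, Measure.restrict_univ] at h2
  rw [h2]
  refine lintegral_congr fun u => ?_
  have := energy_pos u
  have := cmEnergy_pos P u
  have := energy_pos (cmMap P u)
  have := energy_pos (cmMap P (-u))
  rw [det_cmDeriv, abs_of_pos (by positivity), cmMap_neg]

/-! ### Collision weight and pre-post collisional change of variables -/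

/-- The hard-sphere collision weight `v_M g`. -/
def collisionWeight (p q : Mom) : ℝ := mollerVelocity p q * gVar p q

@[fun_prop]
lemma continuous_gVar : Continuous fun z : Mom × Mom => gVar z.1 z.2 := by
  simp only [gVar_eq]; fun_prop

@[fun_prop]
lemma continuous_sVar : Continuous fun z : Mom × Mom => sVar z.1 z.2 := by
  simp only [sVar_eq]; fun_prop

lemma measurable_collisionWeight : Measurable fun z : Mom × Mom => collisionWeight z.1 z.2 := by
  have h1 := continuous_gVar.measurable
  have h2 := continuous_sVar.measurable
  unfold collisionWeight mollerVelocity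
  fun_prop

lemma measurable_boost : Measurable fun z : (Mom × Mom) × S2 =>
    (gVar z.1.1 z.1.2 / 2) • boostedDirection z.1.1 z.1.2 z.2 := by
  have h1 : Measurable fun z : (Mom × Mom) × S2 => gVar z.1.1 z.1.2 :=
    continuous_gVar.measurable.comp measurable_fst
  have h2 : Measurable fun z : (Mom × Mom) × S2 => sVar z.1.1 z.1.2 :=
    continuous_sVar.measurable.comp measurable_fst
  unfold boostedDirection lorentzFactor
  fun_prop

lemma measurable_postP : Measurable fun z : (Mom × Mom) × S2 => postP z.1.1 z.1.2 z.2 := by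
  have := measurable_boost
  unfold postP
  fun_prop

lemma measurable_postQ : Measurable fun z : (Mom × Mom) × S2 => postQ z.1.1 z.1.2 z.2 := by
  have := measurable_boost
  unfold postQ
  fun_prop

lemma collisionWeight_nonneg (p q : Mom) : 0 ≤ collisionWeight p q := by
  have := energy_pos p
  have := energy_pos q
  have := gVar_nonneg p q
  unfold collisionWeight mollerVelocity
  positivity

lemma collisionWeight_cmMap (P u : Mom) : collisionWeight (cmMap P u) (cmMap P (-u))
    = 4 * ‖u‖ ^ 2 * (2 * energy u) / (energy (cmMap P u) * energy (cmMap P (-u))) := by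
  rw [collisionWeight, mollerVelocity, gVar_cmMap, sVar_cmMap,
    Real.sqrt_sq (by linarith [energy_pos u])]
  ring

/-- The factors `p⁰q⁰` cancel, leaving a quantity that depends on `u` only through `|u|`; this makes
the collision measure-preserving. -/
lemma jacobian_mul_collisionWeight (P u : Mom) :
    ENNReal.ofReal (4 * (energy (cmMap P u) * energy (cmMap P (-u))) /
      (2 * energy u * cmEnergy P u)) *
      ENNReal.ofReal (collisionWeight (cmMap P u) (cmMap P (-u)))
      = ENNReal.ofReal (16 * ‖u‖ ^ 2 / cmEnergy P u) := by
  have := energy_pos u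
  have := cmEnergy_pos P u
  have := energy_pos (cmMap P u)
  have := energy_pos (cmMap P (-u))
  rw [← ENNReal.ofReal_mul (by positivity), collisionWeight_cmMap]
  congr 1
  field_simp
  ring

/-- The pre-post collisional change of variables. -/
lemma lintegral_collision {φ F H : Mom → ℝ≥0∞} (hφ : Measurable φ) (hF : Measurable F)
    (hH : Measurable H) :
    ∫⁻ p, ∫⁻ q, ENNReal.ofReal (collisionWeight p q) *
        ∫⁻ ω, φ p * (F (postP p q ω) * H (postQ p q ω)) ∂sphereMeasure
      = ∫⁻ p, ∫⁻ q, ENNReal.ofReal (collisionWeight p q) *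
        ∫⁻ ω, φ (postP p q ω) * (F p * H q) ∂sphereMeasure := by
  have hP := measurable_postP
  have hQ := measurable_postQ
  have hK := measurable_collisionWeight
  have hm : ∀ {X : (Mom × Mom) × S2 → ℝ≥0∞}, Measurable X →
      Measurable (Function.uncurry fun p q => ENNReal.ofReal (collisionWeight p q) *
        ∫⁻ ω, X ((p, q), ω) ∂sphereMeasure) := fun hX =>
    hK.ennreal_ofReal.mul (Measurable.lintegral_prod_right' hX)
  have hcm2 : ∀ {X : (Mom × Mom) × S2 → ℝ≥0∞}, Measurable X →
      ∫⁻ p, ∫⁻ q, ENNReal.ofReal (collisionWeight p q) * ∫⁻ ω, X ((p, q), ω) ∂sphereMeasure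
        = ∫⁻ P, ∫⁻ u, ∫⁻ ω, ENNReal.ofReal (16 * ‖u‖ ^ 2 / cmEnergy P u) *
          X ((cmMap P u, cmMap P (-u)), ω) ∂sphereMeasure := by
    intro X hX
    rw [lintegral_cm (hm hX)]
    refine lintegral_congr fun P => ?_
    refine lintegral_congr fun u => ?_
    rw [← mul_assoc, jacobian_mul_collisionWeight, lintegral_const_mul' _ _ ENNReal.ofReal_ne_top]
  have h1 := hcm2 (X := fun z => φ z.1.1 * (F (postP z.1.1 z.1.2 z.2) *
    H (postQ z.1.1 z.1.2 z.2))) (by fun_prop)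
  have h2 := hcm2 (X := fun z => φ (postP z.1.1 z.1.2 z.2) * (F z.1.1 * H z.1.2)) (by fun_prop)
  refine h1.trans (Eq.trans ?_ h2.symm)
  apply lintegral_congr
  intro P
  have hcm : Measurable (cmMap P) := measurable_cmMap.of_uncurry_left
  have hE : Measurable (cmEnergy P) :=
    continuous_cmEnergy.measurable.of_uncurry_left
  have h := lintegral_swap_direction (X := fun u v =>
    ENNReal.ofReal (16 * ‖u‖ ^ 2 / cmEnergy P u) *
      (φ (cmMap P u) * (F (cmMap P v) * H (cmMap P (-v))))) (by
        unfold Function.uncurry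
        fun_prop)
  simpa only [norm_smul_sphere, cmEnergy_congr P (norm_smul_sphere _ _), postP_cmMap,
    postQ_cmMap] using h

/-! ### Angular integral of the post-collisional weight -/

lemma expWeight_add (k : ℝ) (p q : Mom) :
    expWeight k p * expWeight k q = Real.exp (k * (energy p + energy q)) := by
  rw [expWeight, expWeight, ← Real.exp_add, mul_add]

lemma weight_mul_lintegral_le {k : ℝ} (hk : 0 < k) {p q : Mom} (hpq : p + q ≠ 0) :
    ENNReal.ofReal (collisionWeight p q) *
        ∫⁻ ω, ENNReal.ofReal (expWeight k (postP p q ω)) ∂sphereMeasure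
      ≤ ENNReal.ofReal (16 * sphereConst * k⁻¹ * (Real.sqrt (energy p) * expWeight k p *
          (Real.sqrt (energy q) * expWeight k q) / ‖p + q‖)) := by
  obtain ⟨P, hP⟩ : ∃ P, P = p + q := ⟨_, rfl⟩
  obtain ⟨u, hu⟩ := cmMap_surjective P p
  have hq : cmMap P (-u) = q := by rw [cmMap_neg, hu, hP]; abel
  rw [← hP] at hpq ⊢
  rcases eq_or_ne u 0 with rfl | hu0
  -- For `u = 0` the parameter `β` below would vanish, but so does the collision weight.
  · rw [← hq, ← hu, collisionWeight_cmMap]; simp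
  have hPn : 0 < ‖P‖ := norm_pos_iff.2 hpq
  have hun : 0 < ‖u‖ := norm_pos_iff.2 hu0
  have hR := energy_pos u
  have hp0 := energy_pos p
  have hq0 := energy_pos q
  have hC := sphereConst_pos
  set E := cmEnergy P u with hEdef
  have hE : 0 < E := cmEnergy_pos P u
  have hEpq : energy p + energy q = E := by rw [← hq, ← hu, energy_cmMap_add]
  set β : ℝ := k * ‖u‖ * ‖P‖ / (2 * energy u) with hβdef
  have hβ : 0 < β := by positivity
  have hPE : ‖P‖ ≤ E := Real.le_sqrt_of_sq_le (by linarith [sq_nonneg (2 * energy u)])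
  have hβE : β ≤ k * E / 2 := by
    rw [hβdef, div_le_div_iff₀ (by positivity) two_pos]
    have : ‖u‖ * ‖P‖ ≤ energy u * E := mul_le_mul (norm_le_energy u) hPE hPn.le hR.le
    nlinarith
  have hint : ∫⁻ ω, ENNReal.ofReal (expWeight k (postP p q ω)) ∂sphereMeasure
      ≤ ENNReal.ofReal (Real.exp (k * E / 2) * (sphereConst * Real.exp β / β)) := by
    rw [ENNReal.ofReal_mul (Real.exp_pos _).le]
    refine le_trans (le_of_eq ?_) (mul_le_mul_right (lintegral_sphere_exp_le hβ
      (e := ‖P‖⁻¹ • P) (by simp [norm_smul, hPn.ne'])) _)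
    rw [← lintegral_const_mul' _ _ ENNReal.ofReal_ne_top]
    refine lintegral_congr fun ω => ?_
    rw [← ENNReal.ofReal_mul (Real.exp_pos _).le, ← Real.exp_add, ← hu, ← hq, postP_cmMap,
      expWeight, energy_cmMap, cmEnergy_congr P (norm_smul_sphere u ω),
      energy_congr (norm_smul_sphere u ω), inner_smul_left, inner_smul_right, ← hEdef, hβdef]
    congr 2
    simp only [map_inv₀, conj_trivial]
    field_simp
  refine (mul_le_mul_right hint _).trans ?_
  rw [← ENNReal.ofReal_mul (collisionWeight_nonneg p q)]
  refine ENNReal.ofReal_le_ofReal ?_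
  have hexp : Real.exp (k * E / 2) * Real.exp β ≤ expWeight k p * expWeight k q := by
    rw [expWeight_add, hEpq, ← Real.exp_add]
    exact Real.exp_le_exp.2 (by linarith)
  have hs : (2 * energy u) ^ 2 ≤ 4 * (energy p * energy q) := by
    rw [← sVar_cmMap P u, hu, hq]; exact sVar_le p q
  -- Here `|u| ≤ u⁰ = √s/2 ≤ √(p⁰q⁰)`; this is the origin of the weights `(p⁰)^{1/2}` in the norms.
  have hsqrt : ‖u‖ ≤ Real.sqrt (energy p) * Real.sqrt (energy q) := by
    rw [← Real.sqrt_mul hp0.le]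
    exact Real.le_sqrt_of_sq_le (by nlinarith [energy_sq u])
  have hK : collisionWeight p q / β ≤
      16 * k⁻¹ * (Real.sqrt (energy p) * Real.sqrt (energy q) / ‖P‖) := by
    have h1 : collisionWeight p q / β
        = 4 * k⁻¹ * (‖u‖ * ((2 * energy u) ^ 2 / (energy p * energy q)) / ‖P‖) := by
      have := collisionWeight_cmMap P u
      rw [hu, hq] at this
      rw [this, hβdef]
      field_simp
    have h2 : (2 * energy u) ^ 2 / (energy p * energy q) ≤ 4 := by
      rw [div_le_iff₀ (by positivity)]; exact hs
    rw [h1]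
    calc _ ≤ 4 * k⁻¹ * (Real.sqrt (energy p) * Real.sqrt (energy q) * 4 / ‖P‖) := by gcongr
      _ = _ := by ring
  calc _ = sphereConst * (collisionWeight p q / β) * (Real.exp (k * E / 2) * Real.exp β) := by ring
    _ ≤ sphereConst * (16 * k⁻¹ * (Real.sqrt (energy p) * Real.sqrt (energy q) / ‖P‖)) *
        (expWeight k p * expWeight k q) := by gcongr
    _ = _ := by ring

/-! ### Essential suprema in `x₁` and the bilinear estimate -/

lemma measurable_supNorm {f : unitInterval → Mom → ℝ} (hf : Measurable (Function.uncurry f)) :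
    Measurable (supNorm f) := by
  refine measurable_of_Iic fun a => ?_
  have h : supNorm f ⁻¹' Set.Iic a
      = {p | volume {x : unitInterval | ¬ ‖f x p‖ₑ ≤ a} = 0} := by
    ext p
    simp only [Set.mem_preimage, Set.mem_Iic, Set.mem_ofPred_eq, supNorm, eLpNorm_exponent_top]
    change eLpNormEssSup _ _ ≤ a ↔ ∀ᵐ x, ‖f x p‖ₑ ≤ a
    exact ⟨fun h => (ae_le_eLpNormEssSup).mono fun x hx => hx.trans h,
      eLpNormEssSup_le_of_ae_enorm_bound⟩
  rw [h]
  have hs : MeasurableSet {z : unitInterval × Mom | ¬ ‖f z.1 z.2‖ₑ ≤ a} :=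
    (measurableSet_le (f := fun z : unitInterval × Mom => ‖f z.1 z.2‖ₑ) hf.enorm
      measurable_const).compl
  exact measurable_measure_prodMk_right hs (measurableSet_singleton 0)

lemma ae_le_supNorm (f : unitInterval → Mom → ℝ) (p : Mom) :
    ∀ᵐ x, ENNReal.ofReal (f x p) ≤ supNorm f p := by
  rw [supNorm, eLpNorm_exponent_top]
  filter_upwards [ae_le_eLpNormEssSup (f := fun x => f x p)] with x hx
  refine le_trans ?_ hx
  rw [← ofReal_norm]
  exact ENNReal.ofReal_le_ofReal (le_abs_self _)

lemma supNorm_gain_le {A M : ℝ} (hA : 0 < A) (hM : 0 < M) {σ : ℝ → ℝ → ℝ} {σ₀ : ℝ → ℝ}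
    (hσ : IsHardSphereKernel A M σ σ₀) {f h : unitInterval → Mom → ℝ}
    (hf : Measurable (Function.uncurry f)) (hh : Measurable (Function.uncurry h))
    (hf0 : ∀ x p, 0 ≤ f x p) (hh0 : ∀ x p, 0 ≤ h x p) (p : Mom) :
    supNorm (gain σ f h) p ≤ ENNReal.ofReal (A * M) *
      ∫⁻ q, ENNReal.ofReal (collisionWeight p q) *
        ∫⁻ ω, supNorm f (postP p q ω) * supNorm h (postQ p q ω) ∂sphereMeasure := by
  have hF := measurable_supNorm hf
  have hH := measurable_supNorm hh
  have hP : Measurable fun y : Mom × S2 => postP p y.1 y.2 :=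
    measurable_postP.comp (f := fun y : Mom × S2 => ((p, y.1), y.2)) (by fun_prop)
  have hQ : Measurable fun y : Mom × S2 => postQ p y.1 y.2 :=
    measurable_postQ.comp (f := fun y : Mom × S2 => ((p, y.1), y.2)) (by fun_prop)
  have hfP : Measurable fun z : unitInterval × (Mom × S2) => f z.1 (postP p z.2.1 z.2.2) :=
    hf.comp (measurable_fst.prodMk (hP.comp measurable_snd))
  have hhQ : Measurable fun z : unitInterval × (Mom × S2) => h z.1 (postQ p z.2.1 z.2.2) :=
    hh.comp (measurable_fst.prodMk (hQ.comp measurable_snd))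
  have hae : ∀ᵐ x : unitInterval, ∀ᵐ y : Mom × S2 ∂(volume.prod sphereMeasure),
      ENNReal.ofReal (f x (postP p y.1 y.2)) ≤ supNorm f (postP p y.1 y.2) ∧
        ENNReal.ofReal (h x (postQ p y.1 y.2)) ≤ supNorm h (postQ p y.1 y.2) := by
    -- The exceptional set of `x` depends on the post-collisional momenta; Fubini for null sets
    -- gives one null set of `x` outside which the bounds hold for almost every `(q, ω)`.
    refine (Measure.ae_ae_comm ?_).2 (Filter.Eventually.of_forall fun y =>
      (ae_le_supNorm f _).and (ae_le_supNorm h _))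
    exact (measurableSet_le (f := fun z : unitInterval × (Mom × S2) => _) hfP.ennreal_ofReal
      (hF.comp (hP.comp measurable_snd))).inter
      (measurableSet_le (f := fun z : unitInterval × (Mom × S2) => _) hhQ.ennreal_ofReal
      (hH.comp (hQ.comp measurable_snd)))
  rw [supNorm, eLpNorm_exponent_top]
  refine eLpNormEssSup_le_of_ae_enorm_bound ?_
  filter_upwards [hae] with x hx
  rw [enorm_eq_self, gain, ← lintegral_const_mul' _ _ ENNReal.ofReal_ne_top]
  refine lintegral_mono_ae ?_
  filter_upwards [Measure.ae_ae_of_ae_prod hx] with q hq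
  rw [← mul_assoc, ← ENNReal.ofReal_mul (by positivity),
    ← lintegral_const_mul' _ _ ENNReal.ofReal_ne_top]
  refine lintegral_mono_ae ?_
  filter_upwards [hq] with ω hω
  have hw := collisionWeight_nonneg p q
  have hθ : scatteringAngle p q ω ∈ Set.Icc 0 Real.pi :=
    ⟨Real.arccos_nonneg _, Real.arccos_le_pi _⟩
  have hσle : σ (gVar p q) (scatteringAngle p q ω) ≤ A * (gVar p q * M) :=
    (hσ.upper _ (gVar_nonneg p q) _ hθ).trans (mul_le_mul_of_nonneg_left
      (mul_le_mul_of_nonneg_left (hσ.angular_le _ hθ) (gVar_nonneg p q)) hA.le)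
  have hv : 0 ≤ mollerVelocity p q := by
    have := energy_pos p
    have := energy_pos q
    have := gVar_nonneg p q
    unfold mollerVelocity
    positivity
  have hfh := mul_nonneg (hf0 x (postP p q ω)) (hh0 x (postQ p q ω))
  calc _ ≤ ENNReal.ofReal (A * M * collisionWeight p q *
        (f x (postP p q ω) * h x (postQ p q ω))) := by
        refine ENNReal.ofReal_le_ofReal (mul_le_mul_of_nonneg_right ?_ hfh)
        calc _ ≤ mollerVelocity p q * (A * (gVar p q * M)) :=
              mul_le_mul_of_nonneg_left hσle hv
          _ = _ := by rw [collisionWeight]; ring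
    _ = ENNReal.ofReal (A * M * collisionWeight p q) * (ENNReal.ofReal (f x (postP p q ω)) *
        ENNReal.ofReal (h x (postQ p q ω))) := by
        rw [ENNReal.ofReal_mul (by positivity), ENNReal.ofReal_mul (hf0 _ _)]
    _ ≤ _ := by gcongr; exacts [hω.1, hω.2]

lemma lintegral_gain_le {A M : ℝ} (hA : 0 < A) (hM : 0 < M) {σ : ℝ → ℝ → ℝ} {σ₀ : ℝ → ℝ}
    (hσ : IsHardSphereKernel A M σ σ₀) {k : ℝ} (hk : 0 < k) {f h : unitInterval → Mom → ℝ}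
    (hf : Measurable (Function.uncurry f)) (hh : Measurable (Function.uncurry h))
    (hf0 : ∀ x p, 0 ≤ f x p) (hh0 : ∀ x p, 0 ≤ h x p) :
    ∫⁻ p : Mom, ENNReal.ofReal (expWeight k p) * supNorm (gain σ f h) p
      ≤ ENNReal.ofReal (A * M * (16 * sphereConst) * k⁻¹) * ∫⁻ p, ∫⁻ q,
        ENNReal.ofReal (Real.sqrt (energy p) * expWeight k p *
          (Real.sqrt (energy q) * expWeight k q) / ‖p + q‖) * (supNorm f p * supNorm h q) := by
  have hφ : Measurable fun p => ENNReal.ofReal (expWeight k p) := by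
    unfold expWeight; fun_prop
  have hC := sphereConst_pos
  calc _ ≤ ∫⁻ p, ENNReal.ofReal (A * M) * ∫⁻ q, ENNReal.ofReal (collisionWeight p q) *
        ∫⁻ ω, ENNReal.ofReal (expWeight k p) *
          (supNorm f (postP p q ω) * supNorm h (postQ p q ω)) ∂sphereMeasure := by
        refine lintegral_mono fun p => ?_
        refine (mul_le_mul_right (supNorm_gain_le hA hM hσ hf hh hf0 hh0 p) _).trans (le_of_eq ?_)
        rw [mul_left_comm, ← lintegral_const_mul' _ _ ENNReal.ofReal_ne_top]
        congr 1
        refine lintegral_congr fun q => ?_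
        rw [mul_left_comm, lintegral_const_mul' _ _ ENNReal.ofReal_ne_top]
    _ = ENNReal.ofReal (A * M) * ∫⁻ p, ∫⁻ q, ENNReal.ofReal (collisionWeight p q) *
        ∫⁻ ω, ENNReal.ofReal (expWeight k (postP p q ω)) *
          (supNorm f p * supNorm h q) ∂sphereMeasure := by
        rw [lintegral_const_mul' _ _ ENNReal.ofReal_ne_top,
          lintegral_collision hφ (measurable_supNorm hf) (measurable_supNorm hh)]
    _ ≤ ENNReal.ofReal (A * M) * ∫⁻ p, ∫⁻ q, ENNReal.ofReal (16 * sphereConst * k⁻¹) *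
        (ENNReal.ofReal (Real.sqrt (energy p) * expWeight k p *
          (Real.sqrt (energy q) * expWeight k q) / ‖p + q‖) * (supNorm f p * supNorm h q)) := by
        refine mul_le_mul_right ?_ _
        apply lintegral_mono
        intro p
        apply lintegral_mono_ae
        -- At `q = -p` the real quotient by `|p+q| = 0` is `0`, so the bound could fail there; a
        -- single point is negligible.
        filter_upwards [compl_mem_ae_iff.2 (measure_singleton (μ := volume) (-p))] with q hq
        have hpq : p + q ≠ 0 := fun h => hq (eq_neg_of_add_eq_zero_right h)
        have hφP : Measurable fun ω => ENNReal.ofReal (expWeight k (postP p q ω)) :=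
          hφ.comp (measurable_postP.comp (f := fun ω : S2 => ((p, q), ω)) (by fun_prop))
        rw [lintegral_mul_const _ hφP, ← mul_assoc, ← mul_assoc (ENNReal.ofReal (16 * _ * _)),
          ← ENNReal.ofReal_mul (by positivity)]
        exact mul_le_mul_left (weight_mul_lintegral_le hk hpq) _
    _ = _ := by
        simp only [lintegral_const_mul' _ _ ENNReal.ofReal_ne_top]
        rw [← mul_assoc, ← ENNReal.ofReal_mul (by positivity)]
        ring_nf

/-- The weighted bilinear form with kernel `1 / |p + q|` is bounded by `‖f‖₋₁ ‖h‖`. -/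
lemma lintegral_kernel_le {k : ℝ} {f h : unitInterval → Mom → ℝ}
    (hf : Measurable (Function.uncurry f)) (hh : Measurable (Function.uncurry h)) :
    ∫⁻ q, ∫⁻ p, ENNReal.ofReal (Real.sqrt (energy p) * expWeight k p *
        (Real.sqrt (energy q) * expWeight k q) / ‖p + q‖) * (supNorm f p * supNorm h q)
      ≤ negNorm k f * weightedNorm k h := by
  have hw : Measurable fun q => ENNReal.ofReal (Real.sqrt (energy q) * expWeight k q) := by
    unfold expWeight; fun_prop
  rw [weightedNorm, ← lintegral_const_mul (negNorm k f) (f := fun q => ENNReal.ofReal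
    (Real.sqrt (energy q) * expWeight k q) * supNorm h q) (hw.mul (measurable_supNorm hh))]
  refine lintegral_mono fun q => ?_
  have hm : Measurable fun p => ENNReal.ofReal (Real.sqrt (energy p) * expWeight k p / ‖p - -q‖)
      * supNorm f p := by
    have := measurable_supNorm hf
    unfold expWeight
    fun_prop
  calc _ = ∫⁻ p, ENNReal.ofReal (Real.sqrt (energy p) * expWeight k p / ‖p - -q‖) * supNorm f p *
        (ENNReal.ofReal (Real.sqrt (energy q) * expWeight k q) * supNorm h q) := by
        refine lintegral_congr fun p => ?_
        have h1 : 0 ≤ Real.sqrt (energy p) * expWeight k p / ‖p - -q‖ := by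
          unfold expWeight; positivity
        rw [sub_neg_eq_add] at h1 ⊢
        rw [mul_div_right_comm, ENNReal.ofReal_mul h1]
        ring
    _ = _ := lintegral_mul_const _ hm
    _ ≤ _ := by
        gcongr
        exact le_iSup (fun a => ∫⁻ p : Mom, ENNReal.ofReal (Real.sqrt (energy p) *
          expWeight k p / ‖p - a‖) * supNorm f p) (-q)

end RelBoltzmann

end

open RelBoltzmann in
theorem lemma3p2 (A M : ℝ) (hA : 0 < A) (hM : 0 < M) :
    ∃ C : ℝ, 0 < C ∧
      ∀ (σ : ℝ → ℝ → ℝ) (σ₀ : ℝ → ℝ), IsHardSphereKernel A M σ σ₀ →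
      ∀ k : ℝ, 0 < k →
      ∀ f h : unitInterval → Mom → ℝ,
        Measurable (Function.uncurry f) → Measurable (Function.uncurry h) →
        (∀ x p, 0 ≤ f x p) → (∀ x p, 0 ≤ h x p) →
        (∫⁻ p : Mom, ENNReal.ofReal (expWeight k p) * supNorm (gain σ f h) p
            ≤ ENNReal.ofReal (C * k⁻¹) * negNorm k f * weightedNorm k h) ∧
        (∫⁻ p : Mom, ENNReal.ofReal (expWeight k p) * supNorm (gain σ f h) p
            ≤ ENNReal.ofReal (C * k⁻¹) * negNorm k h * weightedNorm k f) := by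
  have hC := sphereConst_pos
  refine ⟨A * M * (16 * sphereConst), by positivity, ?_⟩
  intro σ σ₀ hσ k hk f h hf hh hf0 hh0
  have hF := measurable_supNorm hf
  have hH := measurable_supNorm hh
  have key := lintegral_gain_le hA hM hσ hk hf hh hf0 hh0
  refine ⟨key.trans ?_, key.trans ?_⟩
  · rw [mul_assoc (ENNReal.ofReal _)]
    refine mul_le_mul_right (le_trans (le_of_eq (lintegral_lintegral_swap
      (Measurable.aemeasurable ?_))) (lintegral_kernel_le hf hh)) _
    unfold Function.uncurry expWeight
    dsimp only
    fun_prop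
  · rw [mul_assoc (ENNReal.ofReal _)]
    refine mul_le_mul_right (le_trans (le_of_eq ?_) (lintegral_kernel_le hh hf)) _
    -- The kernel is symmetric, so the double integral already has the form needed with `f` and `h`
    -- exchanged, without swapping the order of integration.
    refine lintegral_congr fun p => lintegral_congr fun q => ?_
    rw [mul_comm (supNorm f p), add_comm p q, mul_comm (Real.sqrt (energy p) * _)]
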